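/- Let $D\ge 3$ be an integer, $\omega>0$ and $1+\frac4D\le p<1+\frac4{D-2}$. For complex-valued $u\in H^1(\mathbb R^D)$ put $$\mathcal K[u]=\int_{\mathbb R^D}|\nabla u|^2dx+\omega\int_{\mathbb R^D}|u|^2dx,$$ $$\mathcal L[u]=\tfrac12\mathcal K[u]-\tfrac1{p+1}\int_{\mathbb R^D}|u|^{p+1}dx-\tfrac14\int_{\mathbb R^D}(|x|^{-2}*|u|^2)|u|^2dx,$$ $$\mathcal N[u]=\mathcal K[u]-\int_{\mathbb R^D}|u|^{p+1}dx-\int_{\mathbb R^D}(|x|^{-2}*|u|^2)|u|^2dx,$$ $$\mathcal V[u]=\int_{\mathbb R^D}|\nabla u|^2dx-\frac{D(p-1)}{2(p+1)}\int_{\mathbb R^D}|u|^{p+1}dx-\tfrac12\int_{\mathbb R^D}(|x|^{-2}*|u|^2)|u|^2dx,$$ where $*$ denotes convolution on $\mathbb R^D$. Let $$\mathfrak N=\{u\in H^1(\mathbb R^D)\setminus\{0\}:\ \mathcal N[u]=0\},\qquad \mathfrak M=\{u\in H^1(\mathbb R^D):\ \mathcal N[u]<0,\ \mathcal V[u]=0\},$$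 and let $$d_{\mathfrak N}=\inf_{u\in\mathfrak N}\mathcal L[u],\qquad d_{\mathfrak M}=\inf_{u\in\mathfrak M}\mathcal L[u],$$ both infima being taken in the extended reals $[-\infty,+\infty]$. Then $d_{\mathfrak N}\le d_{\mathfrak M}$. -/

import Mathlib

open MeasureTheory

open scoped Convolution

noncomputable section

open scoped ContDiff in
/-- `g` is the weak gradient of the complex valued function `u` on `ℝ^D`: for every real valued
test function `φ ∈ C_c^∞(ℝ^D)` and every `i`, `∫ (∂_i φ) u = - ∫ φ g_i`.
(Real valued test functions suffice, by linearity.) -/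
def HasWeakGrad {D : ℕ} (u : EuclideanSpace ℝ (Fin D) → ℂ)
    (g : EuclideanSpace ℝ (Fin D) → EuclideanSpace ℂ (Fin D)) : Prop :=
  ∀ φ : EuclideanSpace ℝ (Fin D) → ℝ, ContDiff ℝ ∞ φ → HasCompactSupport φ → ∀ i : Fin D,
    ∫ x, (fderiv ℝ φ x (EuclideanSpace.single i 1)) • u x = - ∫ x, φ x • g x i

/-- The space `L²(ℝ^D)` of complex valued functions. -/
abbrev L2Fun (D : ℕ) : Type := Lp ℂ 2 (volume : Measure (EuclideanSpace ℝ (Fin D)))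

/-- The space `L²(ℝ^D)` of vector fields with values in `ℂ^D`. -/
abbrev L2Field (D : ℕ) : Type :=
  Lp (EuclideanSpace ℂ (Fin D)) 2 (volume : Measure (EuclideanSpace ℝ (Fin D)))

/-- The Sobolev space `H¹(ℝ^D)` of complex valued functions: the elements of `L²` that have a weak
gradient in `L²`. -/
def H1 (D : ℕ) : Set (L2Fun D) := {u | ∃ g : L2Field D, HasWeakGrad u g}

open Classical in
/-- The weak gradient `∇u` of `u ∈ H¹(ℝ^D)` (set to be `0` for `u ∉ H¹`). -/
def weakGrad {D : ℕ} (u : L2Fun D) : L2Field D :=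
  if h : ∃ g : L2Field D, HasWeakGrad u g then h.choose else 0

open scoped ContDiff in
/-- The weak gradient is unique, so `weakGrad u` does not depend on any choice. -/
theorem HasWeakGrad.weakGrad_eq {D : ℕ} {u : L2Fun D} {g : L2Field D} (hg : HasWeakGrad u g) :
    weakGrad u = g := by
  have hex : ∃ g : L2Field D, HasWeakGrad u g := ⟨g, hg⟩
  have hw : HasWeakGrad u (weakGrad u) := by
    unfold weakGrad
    rw [dif_pos hex]
    exact hex.choose_spec
  have hcoord : ∀ (v : L2Field D) (i : Fin D), LocallyIntegrable (fun x => v x i) := by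
    intro v i
    have h1 : MemLp (fun x => v x i) 2
        (volume : Measure (EuclideanSpace ℝ (Fin D))) :=
      (EuclideanSpace.proj (𝕜 := ℂ) i : EuclideanSpace ℂ (Fin D) →L[ℂ] ℂ).comp_memLp' (Lp.memLp v)
    exact h1.locallyIntegrable (by norm_num)
  have hi : ∀ i : Fin D, ∀ᵐ x, weakGrad u x i = g x i := by
    intro i
    refine ae_eq_of_integral_contDiff_smul_eq (hcoord _ i) (hcoord _ i) fun φ hφ hc => ?_
    have h1 := hw φ hφ hc i
    have h2 := hg φ hφ hc i
    exact neg_injective (h1.symm.trans h2)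
  refine Lp.ext ?_
  filter_upwards [ae_all_iff.2 hi] with x hx
  ext i
  exact hx i

/-- `∫ |∇u|² dx`. -/
def gradTerm {D : ℕ} (u : L2Fun D) : ℝ := ∫ x, ‖weakGrad u x‖ ^ 2

/-- `∫ |u|² dx`. -/
def massTerm {D : ℕ} (u : L2Fun D) : ℝ := ∫ x, ‖u x‖ ^ 2

/-- `∫ |u|^{p+1} dx`. -/
def powerTerm {D : ℕ} (p : ℝ) (u : L2Fun D) : ℝ := ∫ x, ‖u x‖ ^ (p + 1)

/-- `∫ (|x|^{-2} * |u|²) |u|² dx`, where `*` is the convolution. -/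
def hartreeTerm {D : ℕ} (u : L2Fun D) : ℝ :=
  ∫ x, ((fun y : EuclideanSpace ℝ (Fin D) => (‖y‖ ^ 2)⁻¹)
    ⋆[ContinuousLinearMap.mul ℝ ℝ, volume] (fun y => ‖u y‖ ^ 2)) x * ‖u x‖ ^ 2

/-- `K[u] = ∫ |∇u|² dx + ω ∫ |u|² dx`. -/
def kineticFunctional {D : ℕ} (ω : ℝ) (u : L2Fun D) : ℝ := gradTerm u + ω * massTerm u

/-- The Lagrange functional `L[u]`. -/
def lagrangeFunctional {D : ℕ} (ω p : ℝ) (u : L2Fun D) : ℝ :=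
  1 / 2 * kineticFunctional ω u - 1 / (p + 1) * powerTerm p u - 1 / 4 * hartreeTerm u

/-- The Nehari functional `N[u]`. -/
def nehariFunctional {D : ℕ} (ω p : ℝ) (u : L2Fun D) : ℝ :=
  kineticFunctional ω u - powerTerm p u - hartreeTerm u

/-- The functional `V[u]`. -/
def virialFunctional {D : ℕ} (p : ℝ) (u : L2Fun D) : ℝ :=
  gradTerm u - (D : ℝ) * (p - 1) / (2 * (p + 1)) * powerTerm p u - 1 / 2 * hartreeTerm u

/-- The manifold `𝔑 = {u ∈ H¹ \ {0} : N[u] = 0}`. -/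
def nehariManifold (D : ℕ) (ω p : ℝ) : Set (L2Fun D) :=
  {u | u ∈ H1 D ∧ u ≠ 0 ∧ nehariFunctional ω p u = 0}

/-- The cross constrained manifold `𝔐 = {u ∈ H¹ : N[u] < 0, V[u] = 0}`. -/
def crossManifold (D : ℕ) (ω p : ℝ) : Set (L2Fun D) :=
  {u | u ∈ H1 D ∧ nehariFunctional ω p u < 0 ∧ virialFunctional p u = 0}

/-- `d_𝔑 = inf {L[u] : u ∈ 𝔑}`, as an infimum in the extended reals (so that it is the true
infimum whether or not the set is non-empty and bounded below). -/
def nehariLevel (D : ℕ) (ω p : ℝ) : EReal :=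
  ⨅ u ∈ nehariManifold D ω p, (lagrangeFunctional ω p u : EReal)

/-- `d_𝔐 = inf {L[u] : u ∈ 𝔐}`, as an infimum in the extended reals. -/
def crossLevel (D : ℕ) (ω p : ℝ) : EReal :=
  ⨅ u ∈ crossManifold D ω p, (lagrangeFunctional ω p u : EReal)

end

/-! Given `u` in the cross manifold, follow the curve `u_l(x) = l^{D/2} u(lx)`. It preserves the
mass, multiplies the gradient and Hartree terms by `l^2` and the power term by `l^a`, `a = D(p-1)/2
≥ 2`. As `l → 0`, `N[u_l]` tends to `ω` times the mass, which is positive, while `N[u] < 0`; so some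
`u_l` lies on the Nehari manifold (`exists_dilation_mem_nehariManifold`). Since `V[u] = 0`, `L[u] -
L[u_l]` is a nonnegative multiple of `l^a - 1 - (a/2)(l^2 - 1)`, which is nonnegative by Bernoulli
(`lagrangeFunctional_dilation_le`). The scaling identities are changes of variables and need no
integrability. -/

section Dilation

variable {D : ℕ}

theorem map_smul_volume_euclidean {l : ℝ} (hl : 0 < l) :
    Measure.map (fun x : EuclideanSpace ℝ (Fin D) => l • x) volume
      = ENNReal.ofReal |(l ^ D)⁻¹| • volume := by
  simpa using Measure.map_addHaar_smul (volume : Measure (EuclideanSpace ℝ (Fin D))) hl.ne'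

theorem integral_comp_smul_euclidean {F : Type*} [NormedAddCommGroup F] [NormedSpace ℝ F] {l : ℝ}
    (hl : 0 < l) (f : EuclideanSpace ℝ (Fin D) → F) :
    ∫ x, f (l • x) = (l ^ D)⁻¹ • ∫ x, f x := by
  have h := Measure.integral_comp_smul (volume : Measure (EuclideanSpace ℝ (Fin D))) f l
  rw [finrank_euclideanSpace_fin, abs_of_pos (by positivity)] at h
  exact h

theorem memLp_dilation {F : Type*} [NormedAddCommGroup F] [NormedSpace ℝ F] {l : ℝ} (hl : 0 < l)
    (c : ℝ) {f : EuclideanSpace ℝ (Fin D) → F} (hf : MemLp f 2) :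
    MemLp (fun x => c • f (l • x)) 2 := by
  have h : MemLp f 2 (Measure.map (fun x : EuclideanSpace ℝ (Fin D) => l • x) volume) := by
    rw [map_smul_volume_euclidean hl]
    exact hf.smul_measure ENNReal.ofReal_ne_top
  exact (h.comp_of_map (measurable_const_smul l).aemeasurable).const_smul c

/-- The dilation `x ↦ c f(lx)` of an `L²` function `f`. -/
noncomputable def dilation {F : Type*} [NormedAddCommGroup F] [NormedSpace ℝ F] {l : ℝ} (hl : 0 < l)
    (c : ℝ) (f : Lp F 2 (volume : Measure (EuclideanSpace ℝ (Fin D)))) :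
    Lp F 2 (volume : Measure (EuclideanSpace ℝ (Fin D))) :=
  (memLp_dilation hl c (Lp.memLp f)).toLp _

theorem coeFn_dilation {F : Type*} [NormedAddCommGroup F] [NormedSpace ℝ F] {l : ℝ} (hl : 0 < l)
    (c : ℝ) (f : Lp F 2 (volume : Measure (EuclideanSpace ℝ (Fin D)))) :
    dilation hl c f =ᵐ[volume] fun x => c • f (l • x) :=
  MemLp.coeFn_toLp _

/-- A change of variables moves the dilation onto the test function; the chain rule supplies the
extra factor `l`. -/
theorem HasWeakGrad.dilation {l : ℝ} (hl : 0 < l) (c : ℝ) {u : L2Fun D} {g : L2Field D}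
    (h : HasWeakGrad u g) : HasWeakGrad (dilation hl c u) (dilation hl (c * l) g) := by
  intro φ hφ hc i
  have hψ := h (fun y => φ (l⁻¹ • y)) (hφ.comp (contDiff_const_smul l⁻¹))
    (hc.comp_smul (inv_ne_zero hl.ne')) i
  have hder : ∀ y, fderiv ℝ (fun y => φ (l⁻¹ • y)) y = l⁻¹ • fderiv ℝ φ (l⁻¹ • y) := fun y =>
    fderiv_comp_smul l⁻¹
  have h1 : ∫ x, (fderiv ℝ φ x (EuclideanSpace.single i 1)) • (_root_.dilation hl c u) x
      = (l ^ D)⁻¹ • ∫ y, (c * l) •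
        ((fderiv ℝ (fun y => φ (l⁻¹ • y)) y (EuclideanSpace.single i 1)) • u y) := by
    rw [← integral_comp_smul_euclidean hl]
    refine integral_congr_ae ?_
    filter_upwards [coeFn_dilation hl c u] with x hx
    simp only [hx, hder, inv_smul_smul₀ hl.ne', FunLike.coe_smul, Pi.smul_apply, smul_smul,
      smul_eq_mul]
    congr 1
    field_simp
  have h2 : ∫ x, φ x • (_root_.dilation hl (c * l) g) x i
      = (l ^ D)⁻¹ • ∫ y, (c * l) • (φ (l⁻¹ • y) • g y i) := by
    rw [← integral_comp_smul_euclidean hl]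
    refine integral_congr_ae ?_
    filter_upwards [coeFn_dilation hl (c * l) g] with x hx
    simp only [hx, inv_smul_smul₀ hl.ne', PiLp.smul_apply]
    rw [smul_comm]
  rw [h1, h2, integral_smul,
    integral_smul, hψ, smul_neg, smul_neg]

theorem dilation_mem_H1 {l : ℝ} (hl : 0 < l) (c : ℝ) {u : L2Fun D} (hu : u ∈ H1 D) :
    dilation hl c u ∈ H1 D := by
  obtain ⟨g, hg⟩ := hu
  exact ⟨_, hg.dilation hl c⟩

theorem integral_norm_rpow_dilation {F : Type*} [NormedAddCommGroup F] [NormedSpace ℝ F] {l : ℝ}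
    (hl : 0 < l) {c : ℝ} (hc : 0 < c) (q : ℝ)
    (f : Lp F 2 (volume : Measure (EuclideanSpace ℝ (Fin D)))) :
    ∫ x, ‖dilation hl c f x‖ ^ q = c ^ q * (l ^ D)⁻¹ * ∫ x, ‖f x‖ ^ q := by
  have h1 : ∫ x, ‖dilation hl c f x‖ ^ q = (l ^ D)⁻¹ • ∫ y, c ^ q * ‖f y‖ ^ q := by
    rw [← integral_comp_smul_euclidean hl]
    refine integral_congr_ae ?_
    filter_upwards [coeFn_dilation hl c f] with x hx
    simp only [hx, norm_smul, Real.norm_of_nonneg hc.le]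
    rw [Real.mul_rpow hc.le (norm_nonneg _)]
  rw [h1, integral_const_mul, smul_eq_mul]
  ring

theorem integral_norm_sq_dilation {F : Type*} [NormedAddCommGroup F] [NormedSpace ℝ F] {l : ℝ}
    (hl : 0 < l) {c : ℝ} (hc : 0 < c)
    (f : Lp F 2 (volume : Measure (EuclideanSpace ℝ (Fin D)))) :
    ∫ x, ‖dilation hl c f x‖ ^ 2 = c ^ 2 * (l ^ D)⁻¹ * ∫ x, ‖f x‖ ^ 2 := by
  simpa using integral_norm_rpow_dilation hl hc 2 f

theorem massTerm_dilation {l c : ℝ} (hl : 0 < l) (hc : 0 < c) (hcl : c ^ 2 = l ^ D)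
    (u : L2Fun D) : massTerm (dilation hl c u) = massTerm u := by
  rw [massTerm, integral_norm_sq_dilation hl hc, hcl, mul_inv_cancel₀ (by positivity), one_mul,
    massTerm]

theorem gradTerm_dilation {l c : ℝ} (hl : 0 < l) (hc : 0 < c) (hcl : c ^ 2 = l ^ D)
    {u : L2Fun D} (hu : u ∈ H1 D) : gradTerm (dilation hl c u) = l ^ 2 * gradTerm u := by
  obtain ⟨g, hg⟩ := hu
  rw [gradTerm, gradTerm, (hg.dilation hl c).weakGrad_eq, hg.weakGrad_eq,
    integral_norm_sq_dilation hl (mul_pos hc hl), mul_pow, hcl]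
  field_simp

/-- The kernel is homogeneous of degree `-2`, which gives `l ^ 2`; the two factors `c ^ 2` cancel
the two Jacobians. -/
theorem hartreeTerm_dilation {l c : ℝ} (hl : 0 < l) (hc : 0 < c) (hcl : c ^ 2 = l ^ D)
    (u : L2Fun D) : hartreeTerm (dilation hl c u) = l ^ 2 * hartreeTerm u := by
  set K : EuclideanSpace ℝ (Fin D) → ℝ := fun y => (‖y‖ ^ 2)⁻¹ with hK
  have hconv : ∀ x, (K ⋆[ContinuousLinearMap.mul ℝ ℝ, volume]
      (fun y => ‖dilation hl c u y‖ ^ 2)) x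
      = l ^ 2 * (K ⋆[ContinuousLinearMap.mul ℝ ℝ, volume] (fun y => ‖u y‖ ^ 2)) (l • x) := by
    intro x
    have h1 : ∫ t, K t * ‖dilation hl c u (x - t)‖ ^ 2
        = (l ^ D)⁻¹ • ∫ s, l ^ 2 * c ^ 2 * (K s * ‖u (l • x - s)‖ ^ 2) := by
      rw [← integral_comp_smul_euclidean hl]
      refine integral_congr_ae ?_
      -- The formula for the dilation holds only almost everywhere; the reflection `t ↦ x - t`
      -- respects null sets, so it may be used at `x - t` for every fixed `x`.
      have hq : Measure.QuasiMeasurePreserving (fun t : EuclideanSpace ℝ (Fin D) => x - t)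
          volume volume := (Measure.measurePreserving_sub_left volume x).quasiMeasurePreserving
      filter_upwards [hq.ae (coeFn_dilation hl c u)] with t ht
      simp only [ht, hK, norm_smul, Real.norm_of_nonneg hc.le, Real.norm_of_nonneg hl.le,
        smul_sub, mul_pow, mul_inv]
      field_simp
    simp only [convolution_def, ContinuousLinearMap.mul_apply']
    rw [h1, integral_const_mul, hcl, smul_eq_mul]
    field_simp
  have h2 : hartreeTerm (dilation hl c u) = (l ^ D)⁻¹ • ∫ y, l ^ 2 * c ^ 2 *
      ((K ⋆[ContinuousLinearMap.mul ℝ ℝ, volume] (fun y => ‖u y‖ ^ 2)) y * ‖u y‖ ^ 2) := by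
    rw [← integral_comp_smul_euclidean hl, hartreeTerm]
    refine integral_congr_ae ?_
    filter_upwards [coeFn_dilation hl c u] with x hx
    rw [hconv]
    simp only [hx, norm_smul, Real.norm_of_nonneg hc.le, mul_pow]
    ring
  rw [h2, integral_const_mul, hcl, smul_eq_mul, mul_comm (l ^ 2) (l ^ D), mul_assoc,
    inv_mul_cancel_left₀ (by positivity)]
  rfl

theorem powerTerm_dilation {l : ℝ} (hl : 0 < l) (p : ℝ) (u : L2Fun D) :
    powerTerm p (dilation hl (l ^ ((D : ℝ) / 2)) u)
      = l ^ ((D : ℝ) * (p - 1) / 2) * powerTerm p u := by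
  rw [powerTerm, integral_norm_rpow_dilation hl (Real.rpow_pos_of_pos hl _), powerTerm,
    ← Real.rpow_mul hl.le, ← Real.rpow_natCast, ← Real.rpow_neg hl.le, ← Real.rpow_add hl]
  congr 2
  ring

end Dilation

theorem massTerm_pos {D : ℕ} {u : L2Fun D} (hu : u ≠ 0) : 0 < massTerm u := by
  have hn : ‖u‖ ^ 2 = massTerm u := by
    rw [massTerm, ← RCLike.ofReal_inj (K := ℂ), ← integral_ofReal]
    have := inner_self_eq_norm_sq_to_K (𝕜 := ℂ) u
    rw [L2.inner_def] at this
    simp only [inner_self_eq_norm_sq_to_K] at this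
    push_cast
    exact this.symm
  rw [← hn]
  have := norm_pos_iff.2 hu
  positivity

theorem powerTerm_nonneg {D : ℕ} (p : ℝ) (u : L2Fun D) : 0 ≤ powerTerm p u :=
  integral_nonneg fun _ => by positivity

theorem ne_zero_of_nehariFunctional_neg {D : ℕ} {ω p : ℝ} (hp : p + 1 ≠ 0) {u : L2Fun D}
    (h : nehariFunctional ω p u < 0) : u ≠ 0 := by
  rintro rfl
  have hm : massTerm (0 : L2Fun D) = 0 := integral_eq_zero_of_ae <|
    .of_forall fun x => by simp
  have hP : powerTerm p (0 : L2Fun D) = 0 := integral_eq_zero_of_ae <|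
    .of_forall fun x => by simp [Real.zero_rpow hp]
  have hH : hartreeTerm (0 : L2Fun D) = 0 := integral_eq_zero_of_ae <|
    .of_forall fun x => by simp
  have hG : 0 ≤ gradTerm (0 : L2Fun D) := integral_nonneg fun _ => by positivity
  rw [nehariFunctional, kineticFunctional, hm, hP, hH] at h
  linarith

/-- Along the mass preserving dilations `u_l(x) = l^{D/2} u(lx)`, `0 < l ≤ 1`, the Lagrange
functional is at most its value at `l = 1`, provided that `V[u] = 0`. -/
theorem lagrangeFunctional_dilation_le {D : ℕ} {ω p l : ℝ} (hl : 0 < l)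
    (hp : 0 < p + 1) (hDp : 2 ≤ (D : ℝ) * (p - 1) / 2) {u : L2Fun D} (hu : u ∈ H1 D)
    (hV : virialFunctional p u = 0) :
    lagrangeFunctional ω p (dilation hl (l ^ ((D : ℝ) / 2)) u) ≤ lagrangeFunctional ω p u := by
  have hc : 0 < l ^ ((D : ℝ) / 2) := Real.rpow_pos_of_pos hl _
  have hcl : (l ^ ((D : ℝ) / 2)) ^ 2 = l ^ D := by
    rw [← Real.rpow_natCast, ← Real.rpow_mul hl.le, ← Real.rpow_natCast]
    congr 1
    push_cast
    ring
  rw [lagrangeFunctional, lagrangeFunctional, kineticFunctional, kineticFunctional,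
    gradTerm_dilation hl hc hcl hu, massTerm_dilation hl hc hcl, hartreeTerm_dilation hl hc hcl,
    powerTerm_dilation hl]
  set a := (D : ℝ) * (p - 1) / 2 with ha
  -- Bernoulli for `(1 + s)^{a/2}` with `s = l^2 - 1 ≥ -1`; the exponent is at least `1` because `a
  -- ≥ 2`.
  have hbern : 1 + a / 2 * (l ^ 2 - 1) ≤ l ^ a := by
    have h := one_add_mul_self_le_rpow_one_add (s := l ^ 2 - 1) (p := a / 2)
      (by nlinarith [sq_nonneg l]) (by linarith)
    rw [add_sub_cancel, ← Real.rpow_natCast, ← Real.rpow_mul hl.le] at h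
    simpa [mul_div_cancel₀, add_comm] using h
  have hVe : gradTerm u - 1 / 2 * hartreeTerm u = a * (powerTerm p u / (p + 1)) := by
    rw [virialFunctional] at hV
    rw [ha]
    have : (D : ℝ) * (p - 1) / (2 * (p + 1)) * powerTerm p u
        = (D : ℝ) * (p - 1) / 2 * (powerTerm p u / (p + 1)) := by field_simp
    linarith
  have hq : 0 ≤ powerTerm p u / (p + 1) := div_nonneg (powerTerm_nonneg p u) hp.le
  have hmul := mul_le_mul_of_nonneg_right hbern hq
  have e1 : 1 / (p + 1) * (l ^ a * powerTerm p u) = l ^ a * (powerTerm p u / (p + 1)) := by ring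
  have e2 : 1 / (p + 1) * powerTerm p u = powerTerm p u / (p + 1) := by ring
  rw [e1, e2]
  linear_combination hmul + (l ^ 2 - 1) / 2 * hVe

/-- If `N[u] < 0`, some mass preserving dilation of `u` lies on the Nehari manifold. -/
theorem exists_dilation_mem_nehariManifold {D : ℕ} {ω p : ℝ} (hω : 0 < ω) (hp : 0 < p + 1)
    (hDp : 0 < (D : ℝ) * (p - 1) / 2) {u : L2Fun D} (hu : u ∈ H1 D)
    (hN : nehariFunctional ω p u < 0) :
    ∃ (l : ℝ) (hl : 0 < l), dilation hl (l ^ ((D : ℝ) / 2)) u ∈ nehariManifold D ω p := by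
  have hM := massTerm_pos (ne_zero_of_nehariFunctional_neg hp.ne' hN)
  -- For `l > 0` this is `N[u_l]`; the formula extends continuously to `l = 0`, where there is no
  -- dilation.
  set f : ℝ → ℝ := fun l => l ^ 2 * gradTerm u + ω * massTerm u
    - l ^ ((D : ℝ) * (p - 1) / 2) * powerTerm p u - l ^ 2 * hartreeTerm u with hf
  have hcont : Continuous f := by
    have := Real.continuous_rpow_const hDp.le
    fun_prop
  have hf0 : 0 < f 0 := by
    simp only [hf, Real.zero_rpow hDp.ne']
    have := mul_pos hω hM
    linarith
  have hf1 : f 1 < 0 := by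
    rw [nehariFunctional, kineticFunctional] at hN
    simpa [hf] using hN
  -- The bound `l ≤ 1` can be dropped: the comparison of `L` holds for every `l > 0`.
  obtain ⟨l, ⟨hl0, -⟩, hfl⟩ :=
    intermediate_value_Icc' zero_le_one hcont.continuousOn ⟨hf1.le, hf0.le⟩
  have hl : 0 < l := lt_of_le_of_ne hl0 fun h => by
    rw [← h] at hfl
    exact hf0.ne' hfl
  have hc : 0 < l ^ ((D : ℝ) / 2) := Real.rpow_pos_of_pos hl _
  have hcl : (l ^ ((D : ℝ) / 2)) ^ 2 = l ^ D := by
    rw [← Real.rpow_natCast, ← Real.rpow_mul hl.le, ← Real.rpow_natCast]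
    congr 1
    push_cast
    ring
  refine ⟨l, hl, dilation_mem_H1 hl _ hu, fun h0 => ?_, ?_⟩
  · have hm := massTerm_dilation hl hc hcl u
    have hz : massTerm (0 : L2Fun D) = 0 := integral_eq_zero_of_ae <|
      .of_forall fun x => by simp
    rw [h0, hz] at hm
    exact hM.ne hm
  · rw [nehariFunctional, kineticFunctional, gradTerm_dilation hl hc hcl hu,
      massTerm_dilation hl hc hcl, hartreeTerm_dilation hl hc hcl, powerTerm_dilation hl]
    exact hfl

theorem proposition1p2 (D : ℕ) (hD : 3 ≤ D) (ω p : ℝ) (hω : 0 < ω)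
    (hp : 1 + 4 / (D : ℝ) ≤ p) (hp' : p < 1 + 4 / ((D : ℝ) - 2)) :
    nehariLevel D ω p ≤ crossLevel D ω p := by
  have hD0 : (0 : ℝ) < D := by
    have : 0 < D := by omega
    exact_mod_cast this
  have hDp : 2 ≤ (D : ℝ) * (p - 1) / 2 := by
    have h : 4 / (D : ℝ) ≤ p - 1 := by linarith
    rw [div_le_iff₀ hD0] at h
    linarith
  have hp1 : 0 < p + 1 := by
    have : 0 < 4 / (D : ℝ) := by positivity
    linarith
  refine le_iInf₂ fun u hu => ?_
  obtain ⟨hu1, hN, hV⟩ := hu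
  obtain ⟨l, hl, hmem⟩ :=
    exists_dilation_mem_nehariManifold hω hp1 (by linarith) hu1 hN
  refine (iInf₂_le _ hmem).trans ?_
  exact_mod_cast lagrangeFunctional_dilation_le hl hp1 hDp hu1 hV
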